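/- A partition is written as a weakly increasing sequence of positive integers. Let $h(n,m)$ be the number of partitions of $n$ into $m$ parts in which each part appears at most twice. Let $\lambda$ be a partition in which each part appears at most twice. Reading from left to right, bind neighbouring parts that are equal or consecutive integers into *pairs* $[k,k]$ or $[k,k+1]$, pairing the leftmost parts first and continuing recursively with the parts not yet bound; the remaining parts are *singletons*. A *backward move* on a pair replaces $[k,k+1]$ by $[k-1,k-1]$, or $[k,k]$ by $[k-2,k-1]$; it is allowed if all parts of the result are positive, each appears at most twice, and, when the result is paired again from left to right, all the other pairs (those before and those after the moved one) are unchanged and the moved pair is replaced by exactly one pair. (So a pair may pass singletons, being regrouped with them, but not other pairs.) A backward move on a singleton $x$ lying after all pairs replaces $x$ by $x-1$; it is allowed if all parts of the result are positive, each appears at most twice, and the pairs are unchanged. A *base partition* is a partition (possibly empty) in which each part appears at most twice and on which no backward move on a pair, or on a singleton after all pairs, is allowed. In a base partition a singleton is *moveable* if it lies after all pairs, and *immobile* otherwise. For a base partition $\beta$ let $|\beta|$ be the sum of its parts, and let $n_2$, $n_{11}$, $n_{12}$ be the numbers of its pairs, immobile singletons and moveable singletons; put $n_1=n_{11}+n_{12}$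 and $(a;a)_n=\prod_{i=1}^n(1-a^i)$. Then, as formal power series in $q$ and $t$, $$\sum_{n,m\ge 0}h(n,m)\,q^n t^m=\sum_{\beta}\frac{q^{|\beta|}\,t^{2n_2+n_1}}{(q;q)_{n_{12}}\,(q^3;q^3)_{n_2}},$$ where the sum runs over all base partitions $\beta$. -/

import Mathlib

open scoped MvPowerSeries.WithPiTopology

noncomputable section

namespace PairMoves

/-- A partition (the finite multiset of its parts, which are positive integers) in which every
part appears at most twice. -/
def PartsAtMostTwice (s : Multiset ℕ) : Prop :=
  (∀ x ∈ s, 0 < x) ∧ ∀ x, s.count x ≤ 2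

/-- `h n m` is the number of partitions of `n` into `m` parts with each part appearing at most
twice. -/
def h (n m : ℕ) : ℕ :=
  Nat.card {p : n.Partition // p.parts.card = m ∧ ∀ x, p.parts.count x ≤ 2}

/-- Left-to-right pairing of a weakly increasing list: two neighbours that are equal or consecutive
integers are bound into a pair as soon as they are met, otherwise the smaller one stays alone.
The first component lists the pairs, the second one the remaining parts (the singletons), both in
the order in which they occur. -/
def pairing : List ℕ → List (ℕ × ℕ) × List ℕ
  | [] => ([], [])
  | [a] => ([], [a])
  | a :: b :: l =>
    if b ≤ a + 1 then ((a, b) :: (pairing l).1, (pairing l).2)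
    else ((pairing (b :: l)).1, a :: (pairing (b :: l)).2)

/-- The pairs of a partition, smallest first. -/
def pairs (s : Multiset ℕ) : List (ℕ × ℕ) := (pairing (s.sort (· ≤ ·))).1

/-- The singletons of a partition, smallest first. -/
def singletons (s : Multiset ℕ) : List ℕ := (pairing (s.sort (· ≤ ·))).2

/-- The effect of one backward move on the moved pair: `[k, k+1]` becomes `[k-1, k-1]`, and `[k, k]`
becomes `[k-2, k-1]`. -/
inductive PairStep : ℕ × ℕ → ℕ × ℕ → Prop
  | consecutive (k : ℕ) : PairStep (k + 1, k + 2) (k, k)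
  | repeated (k : ℕ) : PairStep (k + 2, k + 2) (k, k + 1)

/-- `PairMove s s'`: the partition `s'` arises from `s` by one backward move on one of its pairs `P`.
The parts of `P` are replaced as in `PairStep`, and the result must again be a partition with each
part appearing at most twice. The moved pair may pass singletons (it is then regrouped with them,
becoming some pair `Q`), but it may not be moved through or break up another pair: all the other
pairs, those before `P` and those after `P`, must be the same in `s'` as in `s`. -/
def PairMove (s s' : Multiset ℕ) : Prop :=
  PartsAtMostTwice s' ∧
  ∃ (L R : List (ℕ × ℕ)) (P P' Q : ℕ × ℕ),
    PairStep P P' ∧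
    pairs s = L ++ P :: R ∧
    s' + {P.1, P.2} = s + {P'.1, P'.2} ∧
    pairs s' = L ++ Q :: R

/-- The singleton `x` of `s` lies after all the pairs of `s`. -/
def AfterAllPairs (s : Multiset ℕ) (x : ℕ) : Prop := ∀ p ∈ pairs s, p.2 ≤ x

/-- `SingletonMove s s'`: the partition `s'` arises from `s` by one backward move on a singleton
`y + 1` that lies after all the pairs. The singleton becomes `y`, the result must again be a
partition with each part appearing at most twice, and its pairs must be the same. -/
def SingletonMove (s s' : Multiset ℕ) : Prop :=
  PartsAtMostTwice s' ∧
  ∃ y : ℕ, y + 1 ∈ singletons s ∧ AfterAllPairs s (y + 1) ∧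
    s' + {y + 1} = s + {y} ∧
    pairs s' = pairs s

/-- A base partition: each part appears at most twice, no pair can be moved further back, and none
of the singletons after all the pairs can be moved further back. -/
def IsBasePartition (s : Multiset ℕ) : Prop :=
  PartsAtMostTwice s ∧ (∀ s', ¬ PairMove s s') ∧ ∀ s', ¬ SingletonMove s s'

/-- The number of pairs. -/
def n₂ (s : Multiset ℕ) : ℕ := (pairs s).length

open Classical in
/-- The number of immobile singletons of a base partition: the singletons with a pair after them. -/
def n₁₁ (s : Multiset ℕ) : ℕ := (singletons s).countP (fun x => ¬ AfterAllPairs s x)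

open Classical in
/-- The number of moveable singletons of a base partition: the singletons after all the pairs. -/
def n₁₂ (s : Multiset ℕ) : ℕ := (singletons s).countP (fun x => AfterAllPairs s x)

/-- Formal power series in the two commuting variables `q` and `t`. The topology is that of
coefficientwise convergence, where `ℤ` is discrete. -/
abbrev Series : Type := MvPowerSeries (Fin 2) ℤ

/-- The variable `q`. -/
def q : Series := MvPowerSeries.X 0

/-- The variable `t`. -/
def t : Series := MvPowerSeries.X 1

/-- The `q`-shifted factorial `(a; a)_n = (1 - a) (1 - a ^ 2) ⋯ (1 - a ^ n)`. -/
def qPoch (a : Series) (n : ℕ) : Series := ∏ i ∈ Finset.range n, (1 - a ^ (i + 1))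

/-- The inverse `1 / (a; a)_n`, for a series `a` without constant term. -/
def invQPoch (a : Series) (n : ℕ) : Series := MvPowerSeries.invOfUnit (qPoch a n) 1

theorem qPoch_mul_invQPoch (a : Series) (ha : MvPowerSeries.constantCoeff a = 0) (n : ℕ) :
    qPoch a n * invQPoch a n = 1 := by
  apply MvPowerSeries.mul_invOfUnit
  simp [qPoch, map_prod, ha]

/-- The series `∑ h(n, m) q ^ n t ^ m`: its coefficient at `q ^ n t ^ m` is `h n m`. -/
def H : Series := fun e => (h (e 0) (e 1) : ℤ)

end PairMoves

end

noncomputable section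

namespace PairMoves

/-! ### Power series -/

/-! Both sides equal `∏ (1 + q ^ k * t + q ^ (2 * k) * t ^ 2)` over `k ≥ 1`. The proof does not
iterate moves bijectively: it parametrises the base partitions and computes their generating
function.

A partition is a sequence of pairs, recorded by their sums, and singletons. Whether a token may
follow depends only on one number, the level of the token before it (`Admissible`), and level `0`
stands for the start. A backward move lowers the sum of a pair by `3`. Hence in a base partition a
pair following a pair of sum `a` has sum `a + 2`, `a + 3` or `a + 4`. The one exception is `a` odd
with a blocked singleton in between, and then the sum is `a + 5`. The singletons after all pairs are
as small as possible. So base partitions are words over four letters plus a number `r`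
(`baseOfCode_bijective`). One half is `exists_code_of_isBasePartition`, the other
`IsCode.not_pairMove` and `IsCode.not_singletonMove`.

Let `S n a` be the weight of codes with `n` steps from level `a`, and `G a` the sum over `n` of `S n
a / (q³; q³)_n`. Removing the first step gives a recurrence in `n`; by induction it yields
recurrences in `a` (`stepRecurrence`) whose inhomogeneous term carries `1 - q ^ (3 * n)`. That
factor cancels against `(q³; q³)_n`, so `G` satisfies the recurrences obtained by asking whether an
admissible sequence starts with the smallest token its level permits (`codeSeries_even`,
`codeSeries_odd`). They force `G (2c) = (1 + q ^ (c+1) * t + q ^ (2(c+1)) * t ^ 2) * G (2c + 2)`,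
and `G (2K)` tends to `1` in the `q`-adic sense, so `G 0` is the product. -/

theorem hasSum_of_eq {ι : Type*} {f g : ι → Series} {a : Series} (h : ∀ i, f i = g i)
    (hg : HasSum g a) : HasSum f a := by
  rwa [funext h]

theorem hasSum_nat_succ_iff {f : ℕ → Series} {a : Series} (h₀ : f 0 = 0) :
    HasSum (fun n => f (n + 1)) a ↔ HasSum f a := by
  refine Function.Injective.hasSum_iff (Nat.succ_injective) ?_
  intro n hn
  cases n with
  | zero => exact h₀
  | succ n => exact absurd ⟨n, rfl⟩ hn

theorem qPoch_succ (a : Series) (n : ℕ) : qPoch a (n + 1) = qPoch a n * (1 - a ^ (n + 1)) :=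
  Finset.prod_range_succ _ _

theorem one_sub_pow_mul_invQPoch_succ (a : Series) (ha : MvPowerSeries.constantCoeff a = 0)
    (n : ℕ) : (1 - a ^ (n + 1)) * invQPoch a (n + 1) = invQPoch a n := by
  have h₁ := qPoch_mul_invQPoch a ha n
  have h₂ := qPoch_mul_invQPoch a ha (n + 1)
  rw [qPoch_succ] at h₂
  linear_combination invQPoch a n * h₂ - (1 - a ^ (n + 1)) * invQPoch a (n + 1) * h₁

@[simp] theorem invQPoch_zero (a : Series) : invQPoch a 0 = 1 := by
  have h : MvPowerSeries.constantCoeff (qPoch a 0) = ((1 : ℤˣ) : ℤ) := by simp [qPoch]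
  simpa [qPoch, invQPoch] using MvPowerSeries.mul_invOfUnit (qPoch a 0) 1 h

theorem constantCoeff_q : MvPowerSeries.constantCoeff q = 0 := by simp [q]

theorem constantCoeff_q_pow_three : MvPowerSeries.constantCoeff (q ^ 3) = 0 := by simp [q]

theorem q_pow_dvd_iff {n : ℕ} {f : Series} :
    q ^ n ∣ f ↔ ∀ e : Fin 2 →₀ ℕ, e 0 < n → MvPowerSeries.coeff e f = 0 :=
  MvPowerSeries.X_pow_dvd_iff

theorem t_pow_dvd_iff {n : ℕ} {f : Series} :
    t ^ n ∣ f ↔ ∀ e : Fin 2 →₀ ℕ, e 1 < n → MvPowerSeries.coeff e f = 0 :=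
  MvPowerSeries.X_pow_dvd_iff

theorem eq_zero_of_forall_t_pow_dvd {f : Series} (hf : ∀ n, t ^ n ∣ f) : f = 0 := by
  ext e
  exact t_pow_dvd_iff.1 (hf (e 1 + 1)) e (Nat.lt_succ_self _)

/-! ### Step words and their weights -/

/-- A word of steps together with a number of final singletons. A step `some j` stands for a pair
whose sum exceeds the previous one by `j + 2`, a step `none` for an immobile singleton followed by
a pair whose sum exceeds the previous one by `5`. -/
abbrev Code : Type := List (Option (Fin 3)) × ℕ

/-- The number of parts encoded by a code is at least this number. -/
def codeDegree (p : Code) : ℕ := 2 * p.1.length + p.2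

/-- The weight of a code that follows a pair with sum `a`. -/
def weight : ℕ → List (Option (Fin 3)) → ℕ → Series
  | a, [], r => q ^ (r * (a / 2 + r)) * t ^ r * invQPoch q r
  | a, some j :: σ, r => q ^ (a + 2 + j) * t ^ 2 * weight (a + 2 + j) σ r
  | a, none :: σ, r =>
    if Odd a then q ^ (a / 2 + 1 + (a + 5)) * t ^ 3 * weight (a + 5) σ r else 0

theorem t_pow_dvd_weight (σ : List (Option (Fin 3))) (a r : ℕ) :
    t ^ (2 * σ.length + r) ∣ weight a σ r := by
  induction σ generalizing a with
  | nil => exact Dvd.intro_left (q ^ (r * (a / 2 + r)) * invQPoch q r) (by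
      simp only [weight, List.length_nil, mul_zero, zero_add]; exact mul_right_comm _ _ _)
  | cons j σ ih =>
    cases j with
    | none =>
      simp only [weight, List.length_cons]
      split_ifs
      · obtain ⟨c, hc⟩ := ih (a + 5)
        exact ⟨q ^ (a / 2 + 1 + (a + 5)) * t * c, by rw [hc]; ring⟩
      · exact dvd_zero _
    | some j =>
      obtain ⟨c, hc⟩ := ih (a + 2 + j)
      exact ⟨q ^ (a + 2 + j) * c, by simp only [weight, List.length_cons, hc]; ring⟩

theorem q_pow_dvd_weight_nil (a r : ℕ) : q ^ (a / 2 + 1) ∣ weight a [] (r + 1) := by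
  refine Dvd.dvd.mul_right (Dvd.dvd.mul_right (pow_dvd_pow _ ?_) _) _
  nlinarith [Nat.zero_le (a / 2), Nat.zero_le r]

theorem q_pow_dvd_weight_cons (a : ℕ) (j : Option (Fin 3)) (σ : List (Option (Fin 3))) (r : ℕ) :
    q ^ (a / 2 + 1) ∣ weight a (j :: σ) r := by
  cases j with
  | none =>
    simp only [weight]
    split_ifs
    · exact Dvd.dvd.mul_right (Dvd.dvd.mul_right (pow_dvd_pow _ (by omega)) _) _
    · exact dvd_zero _
  | some j => exact Dvd.dvd.mul_right (Dvd.dvd.mul_right (pow_dvd_pow _ (by omega)) _) _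

/-- A family of series indexed by codes is summable if its members have large degree in `t`. -/
theorem summable_of_t_pow_dvd {f : Code → Series} (hf : ∀ p, t ^ codeDegree p ∣ f p) :
    Summable f := by
  rw [MvPowerSeries.WithPiTopology.summable_iff_summable_coeff]
  intro e
  refine summable_of_hasFiniteSupport ?_
  -- The alphabet is finite, so only finitely many codes have degree at most `e 1` in `t`.
  refine Set.Finite.subset
    ((List.finite_length_le (Option (Fin 3)) (e 1)).prod (Set.finite_Iic (e 1))) ?_
  intro p hp
  by_contra hmem
  refine hp (t_pow_dvd_iff.1 (hf p) e ?_)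
  simp only [Set.mem_prod, Set.mem_ofPred_eq, Set.mem_Iic, not_and_or, not_le] at hmem
  unfold codeDegree
  omega

/-- The sum of the weights of the codes with `n` steps. -/
def stepSeries (n a : ℕ) : Series :=
  ∑' p : Code, if p.1.length = n then weight a p.1 p.2 else 0

theorem hasSum_stepSeries (n a : ℕ) :
    HasSum (fun p : Code => if p.1.length = n then weight a p.1 p.2 else 0) (stepSeries n a) := by
  refine (summable_of_t_pow_dvd fun p => ?_).hasSum
  split_ifs
  · exact t_pow_dvd_weight _ _ _
  · exact dvd_zero _

theorem hasSum_stepSeries_zero (a : ℕ) : HasSum (fun r => weight a [] r) (stepSeries 0 a) := by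
  have hinj : Function.Injective (fun r : ℕ => (([], r) : Code)) := fun r r' h => by simpa using h
  have h := (hinj.hasSum_iff ?_).2 (hasSum_stepSeries 0 a)
  · simpa [Function.comp_def] using h
  · rintro ⟨σ, r⟩ hp
    rw [if_neg]
    intro hσ
    exact hp ⟨r, Prod.ext (List.length_eq_zero_iff.1 hσ).symm rfl⟩

theorem stepSeries_succ (n a : ℕ) :
    stepSeries (n + 1) a =
      (∑ j : Fin 3, q ^ (a + 2 + j) * t ^ 2 * stepSeries n (a + 2 + j)) +
        if Odd a then q ^ (a / 2 + 1 + (a + 5)) * t ^ 3 * stepSeries n (a + 5) else 0 := by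
  have hinj : Function.Injective
      (fun p : Option (Fin 3) × Code => ((p.1 :: p.2.1, p.2.2) : Code)) := by
    rintro ⟨j, σ, r⟩ ⟨j', σ', r'⟩ h
    simp_all
  have h := (hinj.hasSum_iff ?_).2 (hasSum_stepSeries (n + 1) a)
  · have hf : ∀ j : Option (Fin 3), HasSum (fun p : Code =>
        if (j :: p.1).length = n + 1 then weight a (j :: p.1) p.2 else 0)
        (match j with
          | none => if Odd a then q ^ (a / 2 + 1 + (a + 5)) * t ^ 3 * stepSeries n (a + 5) else 0
          | some j => q ^ (a + 2 + j) * t ^ 2 * stepSeries n (a + 2 + j)) := by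
      intro j
      cases j with
      | none =>
        split_ifs with ha
        · refine hasSum_of_eq (fun p => ?_)
            ((hasSum_stepSeries n (a + 5)).mul_left (q ^ (a / 2 + 1 + (a + 5)) * t ^ 3))
          simp [weight, ha]
        · refine hasSum_of_eq (fun p => ?_) hasSum_zero
          simp [weight, ha]
      | some j =>
        refine hasSum_of_eq (fun p => ?_)
          ((hasSum_stepSeries n (a + 2 + j)).mul_left (q ^ (a + 2 + j) * t ^ 2))
        simp [weight]
    have hs := (h.prod_fiberwise hf).unique (hasSum_fintype _)
    rw [hs, Fintype.sum_option, add_comm]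
  · rintro ⟨σ, r⟩ hp
    rw [if_neg]
    intro hσ
    cases σ with
    | nil => simp at hσ
    | cons j σ => exact hp ⟨(j, σ, r), rfl⟩

/-! ### Recurrences in the starting level for a fixed number of steps -/

theorem stepSeries_zero_even (c : ℕ) : stepSeries 0 (2 * c) = stepSeries 0 (2 * c + 1) := by
  refine (hasSum_stepSeries_zero _).unique ?_
  convert hasSum_stepSeries_zero (2 * c + 1) using 2 with r
  simp only [weight]
  rw [show (2 * c + 1) / 2 = 2 * c / 2 by omega]

theorem stepSeries_zero_odd (c : ℕ) :
    stepSeries 0 (2 * c + 1) =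
      stepSeries 0 (2 * c + 2) + q ^ (c + 1) * t * stepSeries 0 (2 * c + 4) := by
  have h := (hasSum_stepSeries_zero (2 * c + 1)).sub (hasSum_stepSeries_zero (2 * c + 2))
  rw [← sub_eq_iff_eq_add']
  refine h.unique ?_
  -- The terms `r = 0` cancel. For `r + 1` the difference contains `1 - q ^ (r + 1)`, which removes
  -- the last factor of `(q; q)_{r+1}`.
  refine (hasSum_nat_succ_iff (by simp [weight])).1 (hasSum_of_eq (fun r => ?_)
    ((hasSum_stepSeries_zero (2 * c + 4)).mul_left (q ^ (c + 1) * t)))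
  · simp only [weight]
    rw [show (2 * c + 1) / 2 = c by omega, show (2 * c + 2) / 2 = c + 1 by omega,
      show (2 * c + 4) / 2 = c + 2 by omega,
      ← one_sub_pow_mul_invQPoch_succ q constantCoeff_q r]
    ring

/-- The recurrences in the level `a` satisfied by `stepSeries n a`. -/
def StepRecurrence (n : ℕ) : Prop :=
  (∀ c, stepSeries n (2 * c) = stepSeries n (2 * c + 1) +
    (1 - q ^ (3 * n)) * (q ^ (2 * c + 2) * t ^ 2 * stepSeries (n - 1) (2 * c + 2))) ∧
  ∀ c, stepSeries n (2 * c + 1) =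
    stepSeries n (2 * c + 2) + q ^ (c + 1) * t * stepSeries n (2 * c + 4) +
    (1 - q ^ (3 * n)) * (q ^ (2 * c + 3) * t ^ 2 * stepSeries (n - 1) (2 * c + 3))

theorem stepSeries_succ_even (n c : ℕ) :
    stepSeries (n + 1) (2 * c) =
      q ^ (2 * c + 2) * t ^ 2 * stepSeries n (2 * c + 2) +
      q ^ (2 * c + 3) * t ^ 2 * stepSeries n (2 * c + 3) +
      q ^ (2 * c + 4) * t ^ 2 * stepSeries n (2 * c + 4) := by
  rw [stepSeries_succ, if_neg (by simp), Fin.sum_univ_three]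
  simp [add_assoc]

theorem stepSeries_succ_odd (n c : ℕ) :
    stepSeries (n + 1) (2 * c + 1) =
      q ^ (2 * c + 3) * t ^ 2 * stepSeries n (2 * c + 3) +
      q ^ (2 * c + 4) * t ^ 2 * stepSeries n (2 * c + 4) +
      q ^ (2 * c + 5) * t ^ 2 * stepSeries n (2 * c + 5) +
      q ^ (3 * c + 7) * t ^ 3 * stepSeries n (2 * c + 6) := by
  rw [stepSeries_succ, if_pos (by simp), Fin.sum_univ_three,
    show (2 * c + 1) / 2 + 1 + (2 * c + 1 + 5) = 3 * c + 7 by omega]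
  simp [add_assoc]

/-- Chaining the recurrences through three levels makes their inhomogeneous terms add up to the
first-step expansion of `stepSeries n (2 * c)`, times `1 - q ^ (3 * n)`. This eliminates `n - 1` and
leaves a relation at `n` alone, which drives the induction in `stepRecurrence`. -/
theorem StepRecurrence.shift_even {n : ℕ} (h : StepRecurrence n) (c : ℕ) :
    q ^ (3 * n) * stepSeries n (2 * c) =
      stepSeries n (2 * c + 3) + q ^ (c + 1) * t * stepSeries n (2 * c + 4) := by
  have h₀ := h.1 c
  have h₁ := h.2 c
  have h₂ := h.1 (c + 1)
  cases n with
  | zero =>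
    simp only [mul_add, mul_one, mul_zero, add_assoc, Nat.reduceAdd, pow_zero,
      sub_self, zero_mul, add_zero, one_mul] at *
    linear_combination h₀ + h₁ + h₂
  | succ n =>
    have h₃ := stepSeries_succ_even n c
    simp only [mul_add, mul_one, add_assoc, Nat.reduceAdd,
      Nat.add_sub_cancel] at *
    linear_combination h₀ + h₁ + h₂ - (1 - q ^ (3 * n + 3)) * h₃

theorem StepRecurrence.shift_odd {n : ℕ} (h : StepRecurrence n) (c : ℕ) :
    q ^ (3 * n) * stepSeries n (2 * c + 1) =
      stepSeries n (2 * c + 4) + q ^ (c + 1) * t * stepSeries n (2 * c + 5) +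
        q ^ (c + 2) * t * stepSeries n (2 * c + 6) := by
  have h₀ := h.2 c
  have h₁ := h.1 (c + 1)
  have h₂ := h.2 (c + 1)
  have h₄ := h.1 (c + 2)
  cases n with
  | zero =>
    -- For `n = 0` the truncated index `n - 1` is harmless: its coefficient `1 - q ^ 0` vanishes.
    simp only [mul_add, mul_one, mul_zero, add_assoc, Nat.reduceAdd, pow_zero,
      sub_self, zero_mul, add_zero, one_mul] at *
    linear_combination h₀ + h₁ + h₂ + q ^ (c + 1) * t * h₄
  | succ n =>
    have h₃ := stepSeries_succ_odd n c
    simp only [mul_add, mul_one, add_assoc, Nat.reduceAdd, Nat.reduceMul,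
      Nat.add_sub_cancel] at *
    linear_combination h₀ + h₁ + h₂ + q ^ (c + 1) * t * h₄ - (1 - q ^ (3 * n + 3)) * h₃

theorem stepRecurrence (n : ℕ) : StepRecurrence n := by
  induction n with
  | zero =>
    refine ⟨fun c => ?_, fun c => ?_⟩
    · simpa using stepSeries_zero_even c
    · simpa using stepSeries_zero_odd c
  | succ n ih =>
    refine ⟨fun c => ?_, fun c => ?_⟩
    -- In the difference of the two first-step expansions the middle terms cancel. The shift
    -- identity turns the remaining terms of level `2c + 5` and `2c + 6` into `q ^ (3n + 3)` times
    -- the leading one.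
    · have h := ih.shift_even (c + 1)
      have h₁ := stepSeries_succ_even n c
      have h₂ := stepSeries_succ_odd n c
      simp only [mul_add, mul_one, add_assoc, Nat.reduceAdd,
        Nat.add_sub_cancel] at *
      rw [h₁, h₂]
      linear_combination q ^ (2 * c + 5) * t ^ 2 * h
    · have h := ih.shift_odd (c + 1)
      have h₁ := stepSeries_succ_odd n c
      have h₂ := stepSeries_succ_even n (c + 1)
      have h₃ := stepSeries_succ_even n (c + 2)
      simp only [mul_add, mul_one, add_assoc, Nat.reduceAdd, Nat.reduceMul,
        Nat.add_sub_cancel] at *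
      rw [h₁, h₂, h₃]
      linear_combination q ^ (2 * c + 6) * t ^ 2 * h

/-! ### The generating function of all codes -/

/-- The contribution of a code that follows a pair with sum `a`. -/
def codeTerm (a : ℕ) (p : Code) : Series :=
  weight a p.1 p.2 * invQPoch (q ^ 3) p.1.length

/-- The sum of the contributions of all codes that follow a pair with sum `a`. -/
def codeSeries (a : ℕ) : Series := ∑' p, codeTerm a p

theorem hasSum_codeSeries (a : ℕ) : HasSum (codeTerm a) (codeSeries a) :=
  (summable_of_t_pow_dvd fun _ => (t_pow_dvd_weight _ _ _).mul_right _).hasSum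

/-- Groups the codes by number of steps, since `invQPoch (q ^ 3)` depends on nothing else. -/
theorem hasSum_stepSeries_mul_invQPoch (a : ℕ) :
    HasSum (fun n => stepSeries n a * invQPoch (q ^ 3) n) (codeSeries a) := by
  have hinj : Function.Injective (fun p : Code => (p.1.length, p)) := fun p p' h =>
    (Prod.ext_iff.1 h).2
  have h : HasSum (fun x : ℕ × Code =>
      (if x.2.1.length = x.1 then weight a x.2.1 x.2.2 else 0) * invQPoch (q ^ 3) x.1)
      (codeSeries a) := by
    refine (hinj.hasSum_iff ?_).1 ?_
    · rintro ⟨n, p⟩ hp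
      rw [if_neg, zero_mul]
      intro h
      exact hp ⟨p, Prod.ext h rfl⟩
    · exact hasSum_of_eq (fun p => by simp [codeTerm]) (hasSum_codeSeries a)
  have hf (n : ℕ) : HasSum (fun p : Code =>
      (if p.1.length = n then weight a p.1 p.2 else 0) * invQPoch (q ^ 3) n)
      (stepSeries n a * invQPoch (q ^ 3) n) := (hasSum_stepSeries n a).mul_right _
  exact h.prod_fiberwise hf

/-- The factor `1 - q ^ (3 * n)` is the last one of `(q³; q³)_n`, so cancelling it shifts the
summation index by one. The term `n = 0` is zero. -/
theorem hasSum_one_sub_mul_stepSeries (a : ℕ) :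
    HasSum (fun n => (1 - q ^ (3 * n)) * stepSeries (n - 1) a * invQPoch (q ^ 3) n)
      (codeSeries a) := by
  refine (hasSum_nat_succ_iff (by simp)).1 (hasSum_of_eq (fun n => ?_)
    (hasSum_stepSeries_mul_invQPoch a))
  · rw [← one_sub_pow_mul_invQPoch_succ (q ^ 3) constantCoeff_q_pow_three n, ← pow_mul]
    simp only [Nat.add_sub_cancel]
    ring

theorem codeSeries_even (c : ℕ) :
    codeSeries (2 * c) =
      codeSeries (2 * c + 1) + q ^ (2 * c + 2) * t ^ 2 * codeSeries (2 * c + 2) := by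
  refine (hasSum_stepSeries_mul_invQPoch _).unique ?_
  convert (hasSum_stepSeries_mul_invQPoch (2 * c + 1)).add
    ((hasSum_one_sub_mul_stepSeries (2 * c + 2)).mul_left (q ^ (2 * c + 2) * t ^ 2)) using 2 with n
  rw [(stepRecurrence n).1 c]
  ring

theorem codeSeries_odd (c : ℕ) :
    codeSeries (2 * c + 1) =
      codeSeries (2 * c + 2) + q ^ (c + 1) * t * codeSeries (2 * c + 4) +
        q ^ (2 * c + 3) * t ^ 2 * codeSeries (2 * c + 3) := by
  refine (hasSum_stepSeries_mul_invQPoch _).unique ?_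
  convert ((hasSum_stepSeries_mul_invQPoch (2 * c + 2)).add
    ((hasSum_stepSeries_mul_invQPoch (2 * c + 4)).mul_left (q ^ (c + 1) * t))).add
    ((hasSum_one_sub_mul_stepSeries (2 * c + 3)).mul_left (q ^ (2 * c + 3) * t ^ 2)) using 2 with n
  rw [(stepRecurrence n).2 c]
  ring

/-- The two recurrences show that the defect (left side minus right side) at `c` is a multiple of
`t` times the defect at `c + 1`. It is therefore divisible by every power of `t`, hence zero. -/
theorem codeSeries_odd_eq (c : ℕ) :
    codeSeries (2 * c + 1) = (1 + q ^ (c + 1) * t) * codeSeries (2 * c + 2) := by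
  rw [← sub_eq_zero]
  refine eq_zero_of_forall_t_pow_dvd fun n => ?_
  induction n generalizing c with
  | zero => simp
  | succ n ih =>
    have h₁ := codeSeries_odd c
    have h₂ := codeSeries_even (c + 1)
    obtain ⟨d, hd⟩ := ih (c + 1)
    refine ⟨(q ^ (2 * c + 3) * t - q ^ (c + 1)) * d, ?_⟩
    simp only [mul_add, mul_one, add_assoc, Nat.reduceAdd] at *
    linear_combination h₁ - q ^ (c + 1) * t * h₂ + (q ^ (2 * c + 3) * t ^ 2 - q ^ (c + 1) * t) * hd

theorem codeSeries_even_eq (c : ℕ) :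
    codeSeries (2 * c) =
      (1 + q ^ (c + 1) * t + q ^ (2 * (c + 1)) * t ^ 2) * codeSeries (2 * (c + 1)) := by
  rw [codeSeries_even, codeSeries_odd_eq, show 2 * (c + 1) = 2 * c + 2 by ring]
  ring

theorem codeSeries_zero_eq_prod (K : ℕ) :
    codeSeries 0 =
      (∏ k ∈ Finset.range K, (1 + q ^ (k + 1) * t + q ^ (2 * (k + 1)) * t ^ 2)) *
        codeSeries (2 * K) := by
  induction K with
  | zero => simp
  | succ K ih => rw [ih, Finset.prod_range_succ, codeSeries_even_eq K, mul_assoc]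

/-- The empty code contributes `1`; any other contribution contains a part of size at least `K + 1`.
-/
theorem q_pow_dvd_codeSeries_sub_one (K : ℕ) : q ^ (K + 1) ∣ codeSeries (2 * K) - 1 := by
  rw [q_pow_dvd_iff]
  intro e he
  have h := (MvPowerSeries.WithPiTopology.hasSum_iff_hasSum_coeff.1
    (hasSum_codeSeries (2 * K))) e
  have h' := hasSum_single (f := fun p => MvPowerSeries.coeff e (codeTerm (2 * K) p))
    (([], 0) : Code) ?_
  · rw [map_sub, h.unique h', sub_eq_zero]
    simp [codeTerm, weight]
  · rintro ⟨σ, r⟩ hp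
    refine q_pow_dvd_iff.1 (Dvd.dvd.mul_right ?_ _) e he
    cases σ with
    | nil =>
      cases r with
      | zero => exact absurd rfl hp
      | succ r => simpa using q_pow_dvd_weight_nil (2 * K) r
    | cons j σ => simpa using q_pow_dvd_weight_cons (2 * K) j σ r

theorem coeff_codeSeries_zero (e : Fin 2 →₀ ℕ) :
    MvPowerSeries.coeff e (codeSeries 0) = MvPowerSeries.coeff e
      (∏ k ∈ Finset.range (e 0), (1 + q ^ (k + 1) * t + q ^ (2 * (k + 1)) * t ^ 2)) := by
  rw [← sub_eq_zero, ← map_sub]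
  refine q_pow_dvd_iff.1 ?_ e (Nat.lt_succ_self _)
  obtain ⟨d, hd⟩ := q_pow_dvd_codeSeries_sub_one (e 0)
  rw [codeSeries_zero_eq_prod (e 0)]
  generalize ∏ k ∈ Finset.range (e 0), (1 + q ^ (k + 1) * t + q ^ (2 * (k + 1)) * t ^ 2) = p
  exact ⟨p * d, by rw [Nat.succ_eq_add_one]; linear_combination p * hd⟩

/-! ### The generating function of partitions into parts appearing at most twice -/

/-- The multisets with elements in `[1, K]`, each appearing at most twice. -/
def boundedPartitions : ℕ → Finset (Multiset ℕ)
  | 0 => {0}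
  | K + 1 => (Finset.range 3 ×ˢ boundedPartitions K).image
      fun p => Multiset.replicate p.1 (K + 1) + p.2

theorem mem_boundedPartitions {K : ℕ} {s : Multiset ℕ} :
    s ∈ boundedPartitions K ↔ PartsAtMostTwice s ∧ ∀ x ∈ s, x ≤ K := by
  induction K generalizing s with
  | zero =>
    simp only [boundedPartitions, Finset.mem_singleton]
    refine ⟨?_, fun ⟨⟨h₁, _⟩, h₂⟩ => Multiset.eq_zero_of_forall_notMem fun x hx => ?_⟩
    · rintro rfl
      simp [PartsAtMostTwice]
    · have := h₁ x hx
      have := h₂ x hx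
      omega
  | succ K ih =>
    simp only [boundedPartitions, Finset.mem_image, Finset.mem_product, Finset.mem_range,
      Prod.exists]
    constructor
    · rintro ⟨i, u, ⟨hi, hu⟩, rfl⟩
      obtain ⟨⟨h₁, h₂⟩, h₃⟩ := ih.1 hu
      have h₀ : u.count (K + 1) = 0 := Multiset.count_eq_zero.2 fun h => by
        have := h₃ _ h
        omega
      refine ⟨⟨fun x hx => ?_, fun x => ?_⟩, fun x hx => ?_⟩
      · rcases Multiset.mem_add.1 hx with hx | hx
        · rw [Multiset.eq_of_mem_replicate hx]
          omega
        · exact h₁ x hx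
      · rw [Multiset.count_add, Multiset.count_replicate]
        split_ifs with h
        · subst h
          omega
        · simpa using h₂ x
      · rcases Multiset.mem_add.1 hx with hx | hx
        · rw [Multiset.eq_of_mem_replicate hx]
        · exact (h₃ x hx).trans (Nat.le_succ K)
    · rintro ⟨⟨h₁, h₂⟩, h₃⟩
      refine ⟨s.count (K + 1), s.filter (K + 1 ≠ ·), ⟨Nat.lt_succ_of_le (h₂ _), ih.2 ?_⟩, ?_⟩
      · refine ⟨⟨fun x hx => h₁ x (Multiset.mem_of_mem_filter hx), fun x =>
          (Multiset.count_le_of_le x (Multiset.filter_le _ s)).trans (h₂ x)⟩, fun x hx => ?_⟩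
        have h₄ := h₃ x (Multiset.mem_of_mem_filter hx)
        have h₅ := Multiset.of_mem_filter hx
        omega
      · rw [← Multiset.filter_eq]
        exact Multiset.filter_add_not _ _

theorem prod_eq_sum_boundedPartitions (K : ℕ) :
    ∏ k ∈ Finset.range K, (1 + q ^ (k + 1) * t + q ^ (2 * (k + 1)) * t ^ 2) =
      ∑ s ∈ boundedPartitions K, q ^ s.sum * t ^ s.card := by
  induction K with
  | zero => simp [boundedPartitions]
  | succ K ih =>
    rw [boundedPartitions, Finset.sum_image, Finset.sum_product, Finset.prod_range_succ, ih]
    · have hi : ∀ i : ℕ, ∑ u ∈ boundedPartitions K,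
          q ^ (Multiset.replicate i (K + 1) + u).sum *
            t ^ (Multiset.replicate i (K + 1) + u).card =
          q ^ (i * (K + 1)) * t ^ i * ∑ u ∈ boundedPartitions K, q ^ u.sum * t ^ u.card := by
        intro i
        rw [Finset.mul_sum]
        refine Finset.sum_congr rfl fun u _ => ?_
        simp only [Multiset.sum_add, Multiset.card_add, Multiset.sum_replicate,
          Multiset.card_replicate, smul_eq_mul, pow_add]
        exact mul_mul_mul_comm _ _ _ _
      simp only [hi, Finset.sum_range_succ, Finset.sum_range_zero]
      ring
    · rintro ⟨i, u⟩ hu ⟨i', u'⟩ hu' h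
      have hcount : ∀ (i : ℕ) (u : Multiset ℕ),
          (i, u) ∈ Finset.range 3 ×ˢ boundedPartitions K →
          (Multiset.replicate i (K + 1) + u).count (K + 1) = i := by
        intro i u hu
        rw [Multiset.count_add, Multiset.count_replicate_self, Multiset.count_eq_zero.2, add_zero]
        intro hmem
        have := (mem_boundedPartitions.1 (Finset.mem_product.1 hu).2).2 _ hmem
        omega
      have hi : i = i' := by
        rw [← hcount i u hu, ← hcount i' u' hu']
        exact congrArg _ h
      subst hi
      simpa using h

theorem coeff_q_pow_mul_t_pow (e : Fin 2 →₀ ℕ) (n m : ℕ) :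
    MvPowerSeries.coeff e (q ^ n * t ^ m) = if n = e 0 ∧ m = e 1 then 1 else 0 := by
  classical
  rw [q, t, MvPowerSeries.X_pow_eq, MvPowerSeries.X_pow_eq, MvPowerSeries.monomial_mul_monomial,
    MvPowerSeries.coeff_monomial, one_mul]
  congr 1
  rw [Finsupp.ext_iff, Fin.forall_fin_two]
  simp [eq_comm]

theorem coeff_H (e : Fin 2 →₀ ℕ) :
    MvPowerSeries.coeff e H = MvPowerSeries.coeff e
      (∏ k ∈ Finset.range (e 0), (1 + q ^ (k + 1) * t + q ^ (2 * (k + 1)) * t ^ 2)) := by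
  classical
  rw [prod_eq_sum_boundedPartitions, map_sum]
  simp only [coeff_q_pow_mul_t_pow]
  rw [Finset.sum_boole]
  change ((h (e 0) (e 1) : ℕ) : ℤ) = _
  have hmem {s : Multiset ℕ} : s ∈ {s ∈ boundedPartitions (e 0) | s.sum = e 0 ∧ s.card = e 1} ↔
      PartsAtMostTwice s ∧ s.sum = e 0 ∧ s.card = e 1 := by
    -- No part exceeds the sum, so the bound `e 0` excludes nothing.
    rw [Finset.mem_filter, mem_boundedPartitions]
    exact ⟨fun hs => ⟨hs.1.1, hs.2⟩, fun hs =>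
      ⟨⟨hs.1, fun x hx => (Multiset.le_sum_of_mem hx).trans_eq hs.2.1⟩, hs.2⟩⟩
  rw [h, Nat.card_congr (β := {s // s ∈ {s ∈ boundedPartitions (e 0) |
    s.sum = e 0 ∧ s.card = e 1}})
    { toFun := fun p => ⟨p.1.parts,
        hmem.2 ⟨⟨fun _ => p.1.parts_pos, p.2.2⟩, p.1.parts_sum, p.2.1⟩⟩
      invFun := fun s => ⟨⟨s.1, (hmem.1 s.2).1.1 _, (hmem.1 s.2).2.1⟩,
        (hmem.1 s.2).2.2, (hmem.1 s.2).1.2⟩ },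
    Nat.card_eq_fintype_card, Fintype.card_coe]

theorem codeSeries_zero_eq_H : codeSeries 0 = H := by
  ext e
  rw [coeff_codeSeries_zero, coeff_H]

/-! ### Partitions as sequences of pairs and singletons -/

/-- A constituent of a partition: `pair s` is the pair `[k, k]` or `[k, k + 1]` with sum `s`, and
`single x` is the singleton `x`. -/
inductive Token : Type
  | pair (s : ℕ)
  | single (x : ℕ)

/-- The pair with sum `s`. -/
def pairOfSum (s : ℕ) : ℕ × ℕ := (s / 2, (s + 1) / 2)

theorem pairOfSum_injective : Function.Injective pairOfSum := fun s s' h => by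
  have := Prod.ext_iff.1 h
  simp only [pairOfSum] at this
  omega

namespace Token

/-- The parts of a token. -/
def parts : Token → List ℕ
  | pair s => [s / 2, (s + 1) / 2]
  | single x => [x]

/-- The level of a token bounds the tokens that may follow it, see `Fits`. -/
def level : Token → ℕ
  | pair s => s
  | single x => 2 * x + 2

/-- The token may follow a token of level `a`. -/
def Fits (a : ℕ) : Token → Prop
  | pair s => a + 2 ≤ s
  | single x => a + 1 ≤ 2 * x

theorem Fits.lt_level {a : ℕ} {τ : Token} (h : τ.Fits a) : a < τ.level := by
  cases τ <;> simp only [Fits, level] at * <;> omega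

theorem Fits.mono {a b : ℕ} (hab : b ≤ a) {τ : Token} (h : τ.Fits a) : τ.Fits b := by
  cases τ <;> simp only [Fits] at * <;> omega

end Token

open Token

/-- The parts of a sequence of tokens. -/
def flat (T : List Token) : List ℕ := T.flatMap Token.parts

/-- The pairs in a sequence of tokens. -/
def tokenPairs : List Token → List (ℕ × ℕ)
  | [] => []
  | pair s :: T => pairOfSum s :: tokenPairs T
  | single _ :: T => tokenPairs T

/-- The singletons in a sequence of tokens. -/
def tokenSingles : List Token → List ℕ
  | [] => []
  | pair _ :: T => tokenSingles T
  | single x :: T => x :: tokenSingles T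

/-- The level reached after a sequence of tokens, starting from level `a`. -/
def endLevel : ℕ → List Token → ℕ
  | a, [] => a
  | _, τ :: T => endLevel τ.level T

/-- Every token fits after the preceding one, the first one after level `a`. -/
def Admissible : ℕ → List Token → Prop
  | _, [] => True
  | a, τ :: T => τ.Fits a ∧ Admissible τ.level T

@[simp] theorem flat_nil : flat [] = [] := rfl

@[simp] theorem flat_cons (τ : Token) (T : List Token) : flat (τ :: T) = τ.parts ++ flat T := rfl

@[simp] theorem flat_append (T U : List Token) : flat (T ++ U) = flat T ++ flat U :=
  List.flatMap_append

theorem tokenPairs_append (T U : List Token) :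
    tokenPairs (T ++ U) = tokenPairs T ++ tokenPairs U := by
  induction T with
  | nil => rfl
  | cons τ T ih => cases τ <;> simp [tokenPairs, ih]

theorem mem_tokenPairs {T : List Token} {P : ℕ × ℕ} :
    P ∈ tokenPairs T ↔ ∃ s, pair s ∈ T ∧ P = pairOfSum s := by
  induction T with
  | nil => simp [tokenPairs]
  | cons τ T ih => cases τ <;> simp [tokenPairs, ih, or_and_right, exists_or]

theorem mem_tokenSingles {T : List Token} {x : ℕ} : x ∈ tokenSingles T ↔ single x ∈ T := by
  induction T with
  | nil => simp [tokenSingles]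
  | cons τ T ih => cases τ <;> simp [tokenSingles, ih]

theorem endLevel_append (a : ℕ) (T U : List Token) :
    endLevel a (T ++ U) = endLevel (endLevel a T) U := by
  induction T generalizing a with
  | nil => rfl
  | cons τ T ih => exact ih _

theorem admissible_append {a : ℕ} {T U : List Token} :
    Admissible a (T ++ U) ↔ Admissible a T ∧ Admissible (endLevel a T) U := by
  induction T generalizing a with
  | nil => simp [Admissible, endLevel]
  | cons τ T ih => simp [Admissible, endLevel, ih, and_assoc]

theorem Admissible.mono {a b : ℕ} (hab : b ≤ a) {T : List Token} (h : Admissible a T) :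
    Admissible b T := by
  cases T with
  | nil => trivial
  | cons τ T => exact ⟨h.1.mono hab, h.2⟩

theorem Admissible.fits {a : ℕ} {T : List Token} (h : Admissible a T) : ∀ τ ∈ T, τ.Fits a := by
  induction T generalizing a with
  | nil => simp
  | cons τ T ih =>
    intro τ' hτ'
    rcases List.mem_cons.1 hτ' with rfl | hτ'
    · exact h.1
    · exact (ih h.2 τ' hτ').mono h.1.lt_level.le

/-- Any two different tokens of an admissible sequence are separated. -/
theorem Admissible.fits_or_fits {a : ℕ} {T : List Token} (h : Admissible a T) {τ τ' : Token}
    (hτ : τ ∈ T) (hτ' : τ' ∈ T) (hne : τ ≠ τ') : τ'.Fits τ.level ∨ τ.Fits τ'.level := by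
  induction T generalizing a with
  | nil => simp at hτ
  | cons σ T ih =>
    rcases List.mem_cons.1 hτ with rfl | h₁ <;> rcases List.mem_cons.1 hτ' with rfl | h₂
    · exact absurd rfl hne
    · exact Or.inl (h.2.fits _ h₂)
    · exact Or.inr (h.2.fits _ h₁)
    · exact ih h.2 h₁ h₂

theorem Admissible.lt_of_mem_flat {a : ℕ} {T : List Token} (h : Admissible a T) {x : ℕ}
    (hx : x ∈ flat T) : a < 2 * x := by
  obtain ⟨τ, hτ, hx⟩ := List.mem_flatMap.1 hx
  have := h.fits τ hτ
  cases τ with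
  | pair s =>
    simp only [Token.parts, List.mem_cons, List.not_mem_nil, or_false, Fits] at *
    omega
  | single y =>
    simp only [Token.parts, List.mem_cons, List.not_mem_nil, or_false, Fits] at *
    omega

theorem Admissible.pairwise_flat {a : ℕ} {T : List Token} (h : Admissible a T) :
    (flat T).Pairwise (· ≤ ·) := by
  induction T generalizing a with
  | nil => simp
  | cons τ T ih =>
    rw [flat_cons, List.pairwise_append]
    refine ⟨?_, ih h.2, fun x hx y hy => ?_⟩
    · cases τ <;> simp [Token.parts]
      omega
    · have := h.2.lt_of_mem_flat hy
      cases τ <;>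
        simp only [Token.parts, List.mem_cons, List.not_mem_nil, or_false, level] at * <;> omega

theorem Admissible.count_flat {a : ℕ} {T : List Token} (h : Admissible a T) (x : ℕ) :
    (flat T).count x ≤ 2 ∧ (a + 1 = 2 * x → (flat T).count x ≤ 1) := by
  induction T generalizing a with
  | nil => simp
  | cons τ T ih =>
    have h₁ := h.1
    have h₂ := ih h.2
    have h₃ : 2 * x ≤ τ.level → (flat T).count x = 0 := fun hx =>
      List.count_eq_zero.2 fun hmem => by
        have := h.2.lt_of_mem_flat hmem
        omega
    cases τ with
    | pair s =>
      simp only [flat_cons, Token.parts, List.count_append, List.count_cons, List.count_nil,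
        beq_iff_eq, Fits, level] at *
      split_ifs <;> omega
    | single y =>
      simp only [flat_cons, Token.parts, List.count_append, List.count_cons, List.count_nil,
        beq_iff_eq, Fits, level] at *
      split_ifs <;> omega

theorem Admissible.partsAtMostTwice {T : List Token} (h : Admissible 0 T) :
    PartsAtMostTwice (flat T : Multiset ℕ) :=
  ⟨fun x hx => by
    have := h.lt_of_mem_flat (Multiset.mem_coe.1 hx)
    omega, fun x => (Multiset.coe_count x _).trans_le (h.count_flat x).1⟩

theorem Admissible.pairing_flat {a : ℕ} {T : List Token} (h : Admissible a T) :
    pairing (flat T) = (tokenPairs T, tokenSingles T) := by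
  induction T generalizing a with
  | nil => rfl
  | cons τ T ih =>
    have ih := ih h.2
    cases τ with
    | pair s =>
      simp only [flat_cons, Token.parts, List.cons_append, List.nil_append, pairing, tokenPairs,
        tokenSingles, ih]
      rw [if_pos (by omega)]
      rfl
    | single x =>
      simp only [flat_cons, Token.parts, List.cons_append, List.nil_append, tokenPairs,
        tokenSingles]
      cases hT : flat T with
      | nil =>
        rw [hT] at ih
        simp only [pairing, Prod.mk.injEq] at ih ⊢
        simp [← ih.1, ← ih.2]
      | cons y l =>
        have hy := h.2.lt_of_mem_flat (x := y) (by simp [hT])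
        simp only [level] at hy
        rw [hT] at ih
        rw [pairing, if_neg (by omega), ih]

theorem Admissible.sort_flat {a : ℕ} {T : List Token} (h : Admissible a T) :
    (flat T : Multiset ℕ).sort (· ≤ ·) = flat T := by
  rw [Multiset.coe_sort]
  exact List.mergeSort_of_pairwise (by simpa using h.pairwise_flat)

theorem Admissible.pairs_flat {a : ℕ} {T : List Token} (h : Admissible a T) :
    pairs (flat T : Multiset ℕ) = tokenPairs T := by
  rw [pairs, h.sort_flat, h.pairing_flat]

theorem Admissible.singletons_flat {a : ℕ} {T : List Token} (h : Admissible a T) :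
    singletons (flat T : Multiset ℕ) = tokenSingles T := by
  rw [singletons, h.sort_flat, h.pairing_flat]

/-- Greedy grouping from the left. The level carries all the memory needed: parts must exceed `a /
2`, and for `a` odd the part `(a + 1) / 2` has been used once already, so `hc'` leaves room for only
one more copy. -/
theorem exists_admissible_of_pairwise (l : List ℕ) (a : ℕ) (hl : l.Pairwise (· ≤ ·))
    (ha : ∀ x ∈ l, a < 2 * x) (hc : ∀ x, l.count x ≤ 2)
    (hc' : ∀ x, a + 1 = 2 * x → l.count x ≤ 1) : ∃ T, Admissible a T ∧ flat T = l := by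
  match l with
  | [] => exact ⟨[], trivial, rfl⟩
  | [x] =>
    have := ha x (by simp)
    exact ⟨[single x], ⟨by simp only [Fits]; omega, trivial⟩, rfl⟩
  | x :: y :: l =>
    have hxa := ha x (by simp)
    have hxy : x ≤ y := List.rel_of_pairwise_cons hl (by simp)
    have hl' := List.Pairwise.of_cons hl
    have hyl : ∀ z ∈ l, y ≤ z := fun z hz => List.rel_of_pairwise_cons hl' hz
    by_cases h : y ≤ x + 1
    · obtain ⟨T, hT, hTl⟩ := exists_admissible_of_pairwise l (x + y) (List.Pairwise.of_cons hl')
        (fun z hz => by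
          have h₁ := hyl z hz
          have h₂ := hc z
          have h₃ := List.count_pos_iff.2 hz
          simp only [List.count_cons, beq_iff_eq] at h₂
          split_ifs at h₂ <;> omega)
        (fun z => by
          have h₂ := hc z
          simp only [List.count_cons, beq_iff_eq] at h₂
          omega)
        (fun z hz => by
          have h₂ := hc z
          simp only [List.count_cons, beq_iff_eq] at h₂
          split_ifs at h₂ <;> omega)
      refine ⟨pair (x + y) :: T, ⟨?_, hT⟩, ?_⟩
      · have h₂ := hc' x
        simp only [List.count_cons, beq_iff_eq] at h₂
        simp only [Fits]
        split_ifs at h₂ <;> omega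
      · simp only [flat_cons, Token.parts, hTl, List.cons_append, List.nil_append]
        congr 1
        · omega
        · congr 1
          omega
    · obtain ⟨T, hT, hTl⟩ := exists_admissible_of_pairwise (y :: l) (2 * x + 2) hl'
        (fun z hz => by
          rcases List.mem_cons.1 hz with rfl | hz
          · omega
          · have := hyl z hz
            omega)
        (fun z => by
          have h₂ := hc z
          rw [List.count_cons] at h₂
          omega)
        (fun z hz => by omega)
      exact ⟨single x :: T, ⟨by simp only [Fits]; omega, hT⟩, by simp [Token.parts, hTl]⟩
termination_by l.length

theorem PartsAtMostTwice.exists_admissible {s : Multiset ℕ} (h : PartsAtMostTwice s) :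
    ∃ T, Admissible 0 T ∧ (flat T : Multiset ℕ) = s := by
  obtain ⟨T, hT, hTs⟩ := exists_admissible_of_pairwise (s.sort (· ≤ ·)) 0
    (Multiset.pairwise_sort s _)
    (fun x hx => by
      have := h.1 x ((Multiset.mem_sort _).1 hx)
      omega)
    (fun x => by
      rw [← Multiset.coe_count, Multiset.sort_eq]
      exact h.2 x)
    (fun x hx => by omega)
  exact ⟨T, hT, by rw [hTs, Multiset.sort_eq]⟩

/-- The parts of a sequence of tokens, sorted into those in pairs and singletons. -/
theorem coe_flat (T : List Token) :
    (flat T : Multiset ℕ) =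
      (tokenPairs T).flatMap (fun P => [P.1, P.2]) + (tokenSingles T : Multiset ℕ) := by
  induction T with
  | nil => rfl
  | cons τ T ih =>
    cases τ with
    | pair s =>
      simp [tokenPairs, tokenSingles, Token.parts, pairOfSum, ← Multiset.cons_coe, ih]
    | single x =>
      simp [tokenPairs, tokenSingles, Token.parts, ← Multiset.cons_coe, ih]

/-! ### Backward moves on sequences of tokens -/

theorem pairStep_pairOfSum (s : ℕ) : PairStep (pairOfSum (s + 3)) (pairOfSum s) := by
  obtain ⟨k, rfl | rfl⟩ := Nat.even_or_odd' s
  · convert PairStep.consecutive k using 1 <;> ext <;> simp only [pairOfSum] <;> omega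
  · convert PairStep.repeated k using 1 <;> ext <;> simp only [pairOfSum] <;> omega

theorem PairStep.exists_sum {P P' : ℕ × ℕ} (h : PairStep P P') :
    ∃ s, P = pairOfSum (s + 3) ∧ P' = pairOfSum s := by
  cases h with
  | consecutive k =>
    exact ⟨2 * k, by ext <;> simp only [pairOfSum] <;> omega,
      by ext <;> simp only [pairOfSum] <;> omega⟩
  | repeated k =>
    exact ⟨2 * k + 1, by ext <;> simp only [pairOfSum] <;> omega,
      by ext <;> simp only [pairOfSum] <;> omega⟩

theorem exists_pairMove_of_pair {T U : List Token} {s : ℕ}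
    (h : Admissible 0 (T ++ pair (s + 3) :: U)) (hs : endLevel 0 T + 2 ≤ s) :
    ∃ s', PairMove (flat (T ++ pair (s + 3) :: U)) s' := by
  have h' : Admissible 0 (T ++ pair s :: U) := by
    rw [admissible_append] at h ⊢
    exact ⟨h.1, hs, h.2.2.mono (by simp only [level]; omega)⟩
  refine ⟨flat (T ++ pair s :: U), h'.partsAtMostTwice, tokenPairs T, tokenPairs U, _, _,
    pairOfSum s, pairStep_pairOfSum s, ?_, ?_, ?_⟩
  · rw [h.pairs_flat, tokenPairs_append, tokenPairs]
  · simp only [flat_append, flat_cons, Token.parts, pairOfSum, ← Multiset.coe_add,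
      List.cons_append, List.nil_append, ← Multiset.cons_coe, Multiset.insert_eq_cons,
      ← Multiset.singleton_add]
    abel
  · rw [h'.pairs_flat, tokenPairs_append, tokenPairs]

/-- With `s ≥ 2 * x + 7` the pair moves without meeting `x`. Otherwise it passes `x`, and the three
parts regroup as a pair of sum `p` and a larger singleton `y`. The new pair always fits, except when
it is `[x, x]` and the preceding token leaves room for only one `x`: this is the excluded case. -/
theorem exists_pairMove_of_single_pair {T U : List Token} {x s : ℕ}
    (h : Admissible 0 (T ++ single x :: pair s :: U))
    (hs : ¬ (s = 2 * x + 4 ∧ 2 * x = endLevel 0 T + 1)) :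
    ∃ s', PairMove (flat (T ++ single x :: pair s :: U)) s' := by
  have h₁ := admissible_append.1 h
  have hx := h₁.2.1
  have hs' := h₁.2.2.1
  simp only [Fits, level] at hx hs'
  by_cases hlarge : 2 * x + 7 ≤ s
  · obtain ⟨s, rfl⟩ := Nat.exists_eq_add_of_le' (show 3 ≤ s by omega)
    rw [List.append_cons] at h ⊢
    refine exists_pairMove_of_pair h ?_
    rw [endLevel_append]
    simp only [endLevel, level]
    omega
  obtain ⟨p, y, hp₁, hp₂, hp₃, hy, hparts⟩ : ∃ p y : ℕ, endLevel 0 T + 2 ≤ p ∧ p + 1 ≤ 2 * y ∧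
      2 * y + 2 ≤ s ∧ 2 * y ≤ s ∧
      ({p / 2, (p + 1) / 2, y, s / 2, (s + 1) / 2} : Multiset ℕ) =
        {x, s / 2, (s + 1) / 2, (s - 3) / 2, (s - 3 + 1) / 2} := by
    -- The parts after the move are `x, x, x + 1`, then `x, x + 1, x + 1`, then `x, x + 1, x + 2`.
    obtain rfl | rfl | rfl : s = 2 * x + 4 ∨ s = 2 * x + 5 ∨ s = 2 * x + 6 := by omega
    · refine ⟨2 * x, x + 1, by omega, by omega, by omega, by omega, ?_⟩
      rw [show 2 * x / 2 = x by omega, show (2 * x + 1) / 2 = x by omega,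
        show (2 * x + 4 - 3) / 2 = x by omega, show (2 * x + 4 - 3 + 1) / 2 = x + 1 by omega]
      simp only [Multiset.insert_eq_cons, ← Multiset.singleton_add]
      abel
    · refine ⟨2 * x + 1, x + 1, by omega, by omega, by omega, by omega, ?_⟩
      rw [show (2 * x + 1) / 2 = x by omega, show (2 * x + 1 + 1) / 2 = x + 1 by omega,
        show (2 * x + 5 - 3) / 2 = x + 1 by omega, show (2 * x + 5 - 3 + 1) / 2 = x + 1 by omega]
      simp only [Multiset.insert_eq_cons, ← Multiset.singleton_add]
      abel
    · refine ⟨2 * x + 1, x + 2, by omega, by omega, by omega, by omega, ?_⟩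
      rw [show (2 * x + 1) / 2 = x by omega, show (2 * x + 1 + 1) / 2 = x + 1 by omega,
        show (2 * x + 6 - 3) / 2 = x + 1 by omega, show (2 * x + 6 - 3 + 1) / 2 = x + 2 by omega]
      simp only [Multiset.insert_eq_cons, ← Multiset.singleton_add]
      abel
  have h' : Admissible 0 (T ++ pair p :: single y :: U) :=
    admissible_append.2 ⟨h₁.1, hp₁, hp₂, h₁.2.2.2.mono (by simp only [level]; omega)⟩
  obtain ⟨s, rfl⟩ := Nat.exists_eq_add_of_le' (show 3 ≤ s by omega)
  refine ⟨flat (T ++ pair p :: single y :: U), h'.partsAtMostTwice, tokenPairs T, tokenPairs U,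
    _, _, pairOfSum p, pairStep_pairOfSum s, ?_, ?_, ?_⟩
  · rw [h.pairs_flat, tokenPairs_append, tokenPairs, tokenPairs]
  · rw [Nat.add_sub_cancel] at hparts
    simp only [flat_append, flat_cons, Token.parts, pairOfSum, ← Multiset.coe_add,
      List.cons_append, List.nil_append, ← Multiset.cons_coe, Multiset.insert_eq_cons,
      ← Multiset.singleton_add] at hparts ⊢
    have := congrArg (((flat T : Multiset ℕ) + flat U) + ·) hparts
    convert this using 1 <;> abel
  · rw [h'.pairs_flat, tokenPairs_append, tokenPairs, tokenPairs]

theorem exists_singletonMove {T U : List Token} {x : ℕ}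
    (h : Admissible 0 (T ++ single x :: U)) (hU : tokenPairs U = [])
    (hx : endLevel 0 T + 3 ≤ 2 * x) : ∃ s', SingletonMove (flat (T ++ single x :: U)) s' := by
  obtain ⟨y, rfl⟩ := Nat.exists_eq_add_of_le' (show 1 ≤ x by omega)
  have h₁ := admissible_append.1 h
  have h' : Admissible 0 (T ++ single y :: U) :=
    admissible_append.2 ⟨h₁.1, by simp only [Fits]; omega,
      h₁.2.2.mono (by simp only [level]; omega)⟩
  refine ⟨flat (T ++ single y :: U), h'.partsAtMostTwice, y, ?_, ?_, ?_, ?_⟩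
  · rw [h.singletons_flat, mem_tokenSingles]
    simp
  · intro P hP
    rw [h.pairs_flat, tokenPairs_append, tokenPairs, hU, List.append_nil, mem_tokenPairs] at hP
    obtain ⟨s, hs, rfl⟩ := hP
    have hle := h.pairwise_flat
    rw [flat_append, List.pairwise_append] at hle
    exact hle.2.2 _ (List.mem_flatMap.2 ⟨_, hs, by simp [Token.parts, pairOfSum]⟩) _
      (by simp [Token.parts])
  · simp only [flat_append, flat_cons, Token.parts, ← Multiset.coe_add,
      List.cons_append, List.nil_append, ← Multiset.cons_coe, ← Multiset.singleton_add]
    abel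
  · rw [h.pairs_flat, h'.pairs_flat, tokenPairs_append, tokenPairs_append, tokenPairs, tokenPairs]

/-! ### Base partitions as codes -/

/-- The `r` smallest singletons that may follow level `a`. -/
def finalSingles : ℕ → ℕ → List Token
  | _, 0 => []
  | a, r + 1 => single (a / 2 + 1) :: finalSingles (2 * (a / 2 + 1) + 2) r

/-- The tokens described by a code, starting from level `a`. -/
def decode : ℕ → List (Option (Fin 3)) → ℕ → List Token
  | a, [], r => finalSingles a r
  | a, some j :: σ, r => pair (a + 2 + j) :: decode (a + 2 + j) σ r
  | a, none :: σ, r => single (a / 2 + 1) :: pair (a + 5) :: decode (a + 5) σ r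

/-- The steps `none` occur only after a pair `[k, k + 1]`, when the initial level is `a`. -/
def IsCode : ℕ → List (Option (Fin 3)) → Prop
  | _, [] => True
  | a, some j :: σ => IsCode (a + 2 + j) σ
  | a, none :: σ => Odd a ∧ IsCode (a + 5) σ

theorem admissible_finalSingles (a r : ℕ) : Admissible a (finalSingles a r) := by
  induction r generalizing a with
  | zero => trivial
  | succ r ih => exact ⟨by simp only [Fits]; omega, ih _⟩

theorem IsCode.admissible_decode {a : ℕ} {σ : List (Option (Fin 3))} (h : IsCode a σ) (r : ℕ) :
    Admissible a (decode a σ r) := by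
  induction σ generalizing a with
  | nil => exact admissible_finalSingles a r
  | cons j σ ih =>
    cases j with
    | some j => exact ⟨by simp only [Fits]; omega, ih h⟩
    | none =>
      obtain ⟨⟨k, rfl⟩, h⟩ := h
      exact ⟨by simp only [Fits]; omega, by simp only [Fits, level]; omega, ih h⟩

@[simp] theorem tokenPairs_finalSingles (a r : ℕ) : tokenPairs (finalSingles a r) = [] := by
  induction r generalizing a with
  | zero => rfl
  | succ r ih => exact ih _

theorem length_tokenSingles_finalSingles (a r : ℕ) :
    (tokenSingles (finalSingles a r)).length = r := by
  induction r generalizing a with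
  | zero => rfl
  | succ r ih => simp [finalSingles, tokenSingles, ih]

theorem length_tokenPairs_decode (a : ℕ) (σ : List (Option (Fin 3))) (r : ℕ) :
    (tokenPairs (decode a σ r)).length = σ.length := by
  induction σ generalizing a with
  | nil => simp [decode]
  | cons j σ ih => cases j <;> simp [decode, tokenPairs, ih]

theorem length_flat (T : List Token) :
    (flat T).length = 2 * (tokenPairs T).length + (tokenSingles T).length := by
  induction T with
  | nil => rfl
  | cons τ T ih => cases τ <;> simp [tokenPairs, tokenSingles, Token.parts, ih] <;> ring

theorem sum_flat_finalSingles (a r : ℕ) : (flat (finalSingles a r)).sum = r * (a / 2 + r) := by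
  induction r generalizing a with
  | zero => simp [finalSingles]
  | succ r ih =>
    simp only [finalSingles, flat_cons, Token.parts, List.cons_append, List.nil_append,
      List.sum_cons, ih]
    rw [show (2 * (a / 2 + 1) + 2) / 2 = a / 2 + 2 by omega]
    ring

theorem IsCode.weight_eq {a : ℕ} {σ : List (Option (Fin 3))} (h : IsCode a σ) (r : ℕ) :
    weight a σ r =
      q ^ (flat (decode a σ r)).sum * t ^ (flat (decode a σ r)).length * invQPoch q r := by
  induction σ generalizing a with
  | nil =>
    rw [weight, decode, sum_flat_finalSingles, length_flat, tokenPairs_finalSingles,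
      length_tokenSingles_finalSingles]
    simp
  | cons j σ ih =>
    cases j with
    | some j =>
      simp only [weight, decode, ih h, flat_cons, Token.parts, List.cons_append, List.nil_append,
        List.sum_cons, List.length_cons]
      rw [← add_assoc, show (a + 2 + j) / 2 + (a + 2 + j + 1) / 2 = a + 2 + j by omega, pow_add,
        add_assoc _ 1 1, pow_add]
      ring
    | none =>
      simp only [weight, decode, ih h.2, if_pos h.1, flat_cons, Token.parts, List.cons_append,
        List.nil_append, List.sum_cons, List.length_cons]
      rw [← add_assoc ((a + 5) / 2), show (a + 5) / 2 + (a + 5 + 1) / 2 = a + 5 by omega,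
        ← add_assoc (a / 2 + 1)]
      generalize a / 2 = c
      ring

theorem weight_eq_zero {a : ℕ} {σ : List (Option (Fin 3))} (h : ¬ IsCode a σ) (r : ℕ) :
    weight a σ r = 0 := by
  induction σ generalizing a with
  | nil => exact absurd trivial h
  | cons j σ ih =>
    cases j with
    | some j => rw [weight, ih h, mul_zero]
    | none =>
      rw [weight]
      split_ifs with ha
      · rw [ih fun hσ => h ⟨ha, hσ⟩, mul_zero]
      · rfl

/-- The gaps `2`, `3`, `4`, `5` between successive pair sums identify the four letters. -/
theorem tokenPairs_decode_injective {a : ℕ} {σ σ' : List (Option (Fin 3))} {r r' : ℕ}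
    (h : tokenPairs (decode a σ r) = tokenPairs (decode a σ' r')) : σ = σ' := by
  induction σ generalizing a σ' with
  | nil =>
    have := congrArg List.length h
    rw [length_tokenPairs_decode, length_tokenPairs_decode] at this
    exact (List.length_eq_zero_iff.1 this.symm).symm
  | cons j σ ih =>
    cases σ' with
    | nil =>
      have := congrArg List.length h
      simp [length_tokenPairs_decode] at this
    | cons j' σ' =>
      cases j <;> cases j' <;> simp only [decode, tokenPairs, List.cons.injEq,
        pairOfSum_injective.eq_iff] at h
      · rw [ih h.2]
      · omega
      · omega
      · rename_i j j'
        obtain rfl : j = j' := Fin.ext (by omega)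
        rw [ih h.2]

theorem exists_code_of_isBasePartition {T U : List Token} (h : Admissible 0 (T ++ U))
    (hbase : IsBasePartition (flat (T ++ U) : Multiset ℕ)) :
    ∃ σ r, IsCode (endLevel 0 T) σ ∧ U = decode (endLevel 0 T) σ r := by
  induction U generalizing T with
  | nil => exact ⟨[], 0, trivial, rfl⟩
  | cons τ U ih =>
    have hfits := (admissible_append.1 h).2
    have hend : endLevel 0 (T ++ [τ]) = τ.level := by rw [endLevel_append]; rfl
    obtain ⟨σ, r, hσ, hU⟩ := @ih (T ++ [τ]) (by rwa [← List.append_cons])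
      (by rwa [← List.append_cons])
    rw [hend] at hσ hU
    cases τ with
    | pair s =>
      have hs := hfits.1
      simp only [Fits] at hs
      have hs' : s < endLevel 0 T + 5 := by
        by_contra hlt
        obtain ⟨s, rfl⟩ := Nat.exists_eq_add_of_le' (show 3 ≤ s by omega)
        obtain ⟨s', hs'⟩ := exists_pairMove_of_pair h (by omega)
        exact hbase.2.1 s' hs'
      obtain ⟨j, rfl⟩ := Nat.exists_eq_add_of_le hs
      exact ⟨some ⟨j, by omega⟩ :: σ, r, hσ, by rw [hU]; rfl⟩
    | single x =>
      have hx := hfits.1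
      simp only [Fits, level] at hx hU hσ
      cases σ with
      | nil =>
        have hx' : 2 * x < endLevel 0 T + 3 := by
          by_contra hlt
          obtain ⟨s', hs'⟩ := exists_singletonMove h (by rw [hU]; simp [decode]) (by omega)
          exact hbase.2.2 s' hs'
        refine ⟨[], r + 1, trivial, ?_⟩
        rw [hU, decode, decode, finalSingles, show endLevel 0 T / 2 + 1 = x by omega]
      | cons j σ =>
        cases j with
        -- The level `2 * x + 2` of a singleton is even, so two singletons never precede the same
        -- pair directly.
        | none => exact absurd hσ.1 (by simp [parity_simps])
        | some j =>
          rw [decode] at hU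
          subst hU
          have hj : 2 * x + 2 + 2 + j = 2 * x + 4 ∧ 2 * x = endLevel 0 T + 1 := by
            by_contra hne
            obtain ⟨s', hs'⟩ := exists_pairMove_of_single_pair h hne
            exact hbase.2.1 s' hs'
          -- The blocked singleton and the pair after it merge into a single step `none`.
          have h₅ : 2 * x + 2 + 2 + j = endLevel 0 T + 5 := by omega
          refine ⟨none :: σ, r, ⟨⟨x - 1, by omega⟩, h₅ ▸ hσ⟩, ?_⟩
          rw [decode, h₅, show endLevel 0 T / 2 + 1 = x by omega]

theorem Admissible.pairwise_tokenPairs {a : ℕ} {T : List Token} (h : Admissible a T) :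
    (tokenPairs T).Pairwise fun P Q => P.1 + P.2 + 2 ≤ Q.1 + Q.2 := by
  induction T generalizing a with
  | nil => exact List.Pairwise.nil
  | cons τ T ih =>
    cases τ with
    | single x => exact ih h.2
    | pair s =>
      refine List.Pairwise.cons (fun Q hQ => ?_) (ih h.2)
      obtain ⟨s', hs', rfl⟩ := mem_tokenPairs.1 hQ
      have := h.2.fits _ hs'
      simp only [Fits, level, pairOfSum] at *
      omega

/-- The possible positions of a pair of a decoded sequence relative to the preceding pair. -/
theorem IsCode.pair_gap {a : ℕ} {σ : List (Option (Fin 3))} (h : IsCode a σ) {r : ℕ}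
    {L R : List (ℕ × ℕ)} {P : ℕ × ℕ} (hL : tokenPairs (decode a σ r) = L ++ P :: R) :
    ∃ b p, P = pairOfSum p ∧ (L = [] ∧ b = a ∨ ∃ L', L = L' ++ [pairOfSum b]) ∧ b + 2 ≤ p ∧
      (p ≤ b + 4 ∨ p = b + 5 ∧ Odd b ∧ single (b / 2 + 1) ∈ decode a σ r) := by
  induction σ generalizing a L with
  | nil => simp [decode] at hL
  | cons j σ ih =>
    cases L with
    | nil =>
      cases j with
      | some j =>
        simp only [decode, tokenPairs, List.nil_append, List.cons.injEq] at hL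
        exact ⟨a, _, hL.1.symm, Or.inl ⟨rfl, rfl⟩, by omega, Or.inl (by omega)⟩
      | none =>
        simp only [decode, tokenPairs, List.nil_append, List.cons.injEq] at hL
        exact ⟨a, _, hL.1.symm, Or.inl ⟨rfl, rfl⟩, by omega, Or.inr ⟨rfl, h.1, by simp [decode]⟩⟩
    | cons P₀ L =>
      obtain ⟨c, hP₀, hc, hL, hmem⟩ : ∃ c, pairOfSum c = P₀ ∧ IsCode c σ ∧
          tokenPairs (decode c σ r) = L ++ P :: R ∧ ∀ τ ∈ decode c σ r, τ ∈ decode a (j :: σ) r := by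
        cases j with
        | some j =>
          simp only [decode, tokenPairs, List.cons_append, List.cons.injEq] at hL
          exact ⟨_, hL.1, h, hL.2, fun τ hτ => by simp [decode, hτ]⟩
        | none =>
          simp only [decode, tokenPairs, List.cons_append, List.cons.injEq] at hL
          exact ⟨_, hL.1, h.2, hL.2, fun τ hτ => by simp [decode, hτ]⟩
      obtain ⟨b, p, hP, hb, hbp, hgap⟩ := ih hc hL
      refine ⟨b, p, hP, Or.inr ?_, hbp, hgap.imp_right fun hg => ⟨hg.1, hg.2.1, hmem _ hg.2.2⟩⟩
      rcases hb with ⟨rfl, rfl⟩ | ⟨L', rfl⟩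
      · exact ⟨[], by rw [hP₀]; rfl⟩
      · exact ⟨P₀ :: L', rfl⟩

theorem exists_level_of_single_mem_finalSingles {a r x : ℕ} (hx : single x ∈ finalSingles a r) :
    x = a / 2 + 1 ∨ ∃ y, single y ∈ finalSingles a r ∧ x = y + 2 := by
  induction r generalizing a with
  | zero => simp [finalSingles] at hx
  | succ r ih =>
    simp only [finalSingles, List.mem_cons, single.injEq] at hx ⊢
    rcases hx with rfl | hx
    · exact Or.inl rfl
    · rcases ih hx with h | ⟨y, hy, h⟩
      · exact Or.inr ⟨_, Or.inl rfl, by omega⟩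
      · exact Or.inr ⟨y, Or.inr hy, h⟩

/-- A singleton of a decoded sequence is as small as the preceding token allows. -/
theorem exists_level_of_single_mem_decode {a : ℕ} {σ : List (Option (Fin 3))} {r x : ℕ}
    (hx : single x ∈ decode a σ r) :
    x = a / 2 + 1 ∨ (∃ y, single y ∈ decode a σ r ∧ x = y + 2) ∨
      ∃ s, pair s ∈ decode a σ r ∧ x = s / 2 + 1 := by
  induction σ generalizing a with
  | nil => exact (exists_level_of_single_mem_finalSingles hx).imp_right Or.inl
  | cons j σ ih =>
    cases j with
    | some j =>
      simp only [decode, List.mem_cons, reduceCtorEq, false_or, pair.injEq] at hx ⊢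
      rcases ih hx with h | ⟨y, hy, h⟩ | ⟨s, hs, h⟩
      · exact Or.inr (Or.inr ⟨_, Or.inl rfl, h⟩)
      · exact Or.inr (Or.inl ⟨y, hy, h⟩)
      · exact Or.inr (Or.inr ⟨s, Or.inr hs, h⟩)
    | none =>
      simp only [decode, List.mem_cons, reduceCtorEq, false_or, pair.injEq, single.injEq] at hx ⊢
      rcases hx with rfl | hx
      · exact Or.inl rfl
      rcases ih hx with h | ⟨y, hy, h⟩ | ⟨s, hs, h⟩
      · exact Or.inr (Or.inr ⟨_, Or.inl rfl, h⟩)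
      · exact Or.inr (Or.inl ⟨y, Or.inr hy, h⟩)
      · exact Or.inr (Or.inr ⟨s, Or.inr hs, h⟩)

/-- Since the pairs are unchanged, `y` must be a singleton of the result. But then `y = 0`, or `y -
1` is also a singleton, or `y` is the smaller part of a pair; an admissible sequence allows none of
these. -/
theorem IsCode.not_singletonMove {σ : List (Option (Fin 3))} (h : IsCode 0 σ) (r : ℕ)
    (s' : Multiset ℕ) : ¬ SingletonMove (flat (decode 0 σ r)) s' := by
  rintro ⟨hs', y, hy, -, heq, hpairs⟩
  have hT := h.admissible_decode r
  obtain ⟨T', hT', rfl⟩ := hs'.exists_admissible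
  rw [hT.singletons_flat, mem_tokenSingles] at hy
  rw [hT.pairs_flat, hT'.pairs_flat] at hpairs
  rw [coe_flat, coe_flat, hpairs, add_assoc, add_assoc, add_right_inj] at heq
  have hmem : ∀ z, z ≠ y + 1 → (z = y ∨ single z ∈ decode 0 σ r) → single z ∈ T' := by
    intro z hz hz'
    have : z ∈ (tokenSingles T' : Multiset ℕ) + {y + 1} := by
      rw [heq]
      simpa [mem_tokenSingles, or_comm] using hz'
    simpa [mem_tokenSingles, hz] using this
  have hy' := hmem y (by omega) (Or.inl rfl)
  rcases exists_level_of_single_mem_decode hy with h₁ | ⟨z, hz, h₁⟩ | ⟨s, hs, h₁⟩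
  · have := hT'.fits _ hy'
    simp only [Fits] at this
    omega
  · have hz' := hmem z (by omega) (Or.inr hz)
    have := hT'.fits_or_fits hy' hz' (by rw [ne_eq, single.injEq]; omega)
    simp only [Fits, level] at this
    omega
  · have hs' : pairOfSum s ∈ tokenPairs T' := by
      rw [hpairs]
      exact mem_tokenPairs.2 ⟨s, hs, rfl⟩
    obtain ⟨s₁, hs₁, hss⟩ := mem_tokenPairs.1 hs'
    rw [← pairOfSum_injective hss] at hs₁
    have := hT'.fits_or_fits hy' hs₁ (by simp)
    simp only [Fits, level] at this
    omega

/-- The moved pair lands so close to its predecessor, which must survive, that some part is `0` or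
occurs three times. In one further case the pairing itself changes. -/
theorem IsCode.not_pairMove {σ : List (Option (Fin 3))} (h : IsCode 0 σ) (r : ℕ)
    (s' : Multiset ℕ) : ¬ PairMove (flat (decode 0 σ r)) s' := by
  rintro ⟨hs', L, R, P, P', Q, hstep, hL, heq, hL'⟩
  have hT := h.admissible_decode r
  obtain ⟨T', hT', rfl⟩ := hs'.exists_admissible
  obtain ⟨u, rfl, rfl⟩ := hstep.exists_sum
  rw [hT.pairs_flat] at hL
  rw [hT'.pairs_flat] at hL'
  obtain ⟨b, p, hP, hb, hbp, hgap⟩ := h.pair_gap hL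
  obtain rfl := pairOfSum_injective hP
  have hcount (x : ℕ) : (flat T').count x + [(u + 3) / 2, (u + 3 + 1) / 2].count x =
      (flat (decode 0 σ r)).count x + [u / 2, (u + 1) / 2].count x := by
    have hpair (a b : ℕ) : ({a, b} : Multiset ℕ) = ([a, b] : List ℕ) := rfl
    simpa only [pairOfSum, hpair, Multiset.count_add, Multiset.coe_count] using
      congrArg (Multiset.count x) heq
  have hsplit (T : List Token) (x : ℕ) : (flat T).count x =
      ((tokenPairs T).flatMap fun P => [P.1, P.2]).count x + (tokenSingles T).count x := by
    simpa only [Multiset.count_add, Multiset.coe_count] using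
      congrArg (Multiset.count x) (coe_flat T)
  rcases hb with ⟨rfl, rfl⟩ | ⟨L, rfl⟩
  · have h₀ : (flat T').count 0 = 0 := List.count_eq_zero.2 fun h₀ =>
      absurd (hs'.1 0 h₀) (lt_irrefl 0)
    have h₁ := hcount 0
    have hu : u / 2 = 0 := by
      rcases hgap with hgap | ⟨-, hodd, -⟩
      · omega
      · simp at hodd
    simp only [h₀, List.count_cons, List.count_nil, beq_iff_eq, hu] at h₁
    split_ifs at h₁ <;> omega
  · simp only [hsplit, hL, hL', List.flatMap_append, List.flatMap_cons, List.flatMap_nil,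
      List.count_append, List.count_cons, List.count_nil, beq_iff_eq, pairOfSum] at hcount
    have htwice (x : ℕ) := (hT'.count_flat x).1
    simp only [hsplit, hL', List.flatMap_append, List.flatMap_cons, List.flatMap_nil,
      List.count_append, List.count_cons, List.count_nil, beq_iff_eq, pairOfSum] at htwice
    obtain ⟨k, rfl | rfl⟩ := Nat.even_or_odd' b
    -- The preceding pair is `[k, k]`, and the lowered pair contains a third `k`.
    · have h₁ := hcount k
      have h₂ := htwice k
      have hu : u ≤ 2 * k + 1 := by
        rcases hgap with hgap | ⟨-, hodd, -⟩
        · omega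
        · obtain ⟨m, hm⟩ := hodd
          omega
      rw [if_pos (show 2 * k / 2 = k by omega), if_pos (show (2 * k + 1) / 2 = k by omega)] at h₁ h₂
      split_ifs at h₁ h₂ <;> omega
    · have hdiv (j : ℕ) : (2 * k + j) / 2 = k + j / 2 := by omega
      obtain rfl | rfl | rfl | ⟨rfl, hk⟩ : u = 2 * k ∨ u = 2 * k + 1 ∨ u = 2 * k + 2 ∨
          (u = 2 * k + 3 ∧ 1 ≤ (tokenSingles (decode 0 σ r)).count (k + 1)) := by
        rcases hgap with hgap | ⟨hu, -, hmem⟩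
        · omega
        · rw [show (2 * k + 1) / 2 = k by omega] at hmem
          exact Or.inr (Or.inr (Or.inr ⟨by omega, List.one_le_count_iff.2
            (mem_tokenSingles.2 hmem)⟩))
      -- Preceding pair `[k, k + 1]`, lowered pair `[k, k]`: three copies of `k`.
      · have h₁ := hcount k
        have h₂ := htwice k
        simp [add_assoc, hdiv] at h₁ h₂
        omega
      -- The parts `k, k, k + 1, k + 1` respect the multiplicities but would be paired as `[k, k],
      -- [k + 1, k + 1]`. If `[k, k + 1]` is kept, the later pair `Q` is too large to contain `k`,
      -- so the second `k` is a singleton, which cannot stand next to `[k, k + 1]`.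
      · have hpw := hT'.pairwise_tokenPairs
        rw [hL', List.pairwise_append] at hpw
        have hQ := hpw.2.2 (pairOfSum (2 * k + 1)) (by simp) Q (by simp)
        obtain ⟨s, -, rfl⟩ := mem_tokenPairs.1 (show Q ∈ tokenPairs T' by simp [hL'])
        have hk : single k ∈ T' := by
          refine mem_tokenSingles.1 (List.one_le_count_iff.1 ?_)
          have h₁ := hcount k
          simp only [pairOfSum] at hQ
          have hQ₁ : s / 2 ≠ k := by omega
          have hQ₂ : (s + 1) / 2 ≠ k := by omega
          simp [pairOfSum, add_assoc, hdiv, hQ₁, hQ₂] at h₁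
          omega
        obtain ⟨s', hs', hss⟩ := mem_tokenPairs.1
          (show pairOfSum (2 * k + 1) ∈ tokenPairs T' by simp [hL'])
        rw [← pairOfSum_injective hss] at hs'
        have := hT'.fits_or_fits hk hs' (by simp)
        simp only [Fits, level] at this
        omega
      · have h₁ := hcount (k + 1)
        have h₂ := htwice (k + 1)
        simp [add_assoc, hdiv] at h₁ h₂
        omega
      -- The third copy of `k + 1` is the immobile singleton, supplied by `hk`.
      · have h₁ := hcount (k + 1)
        have h₂ := htwice (k + 1)
        simp [add_assoc, hdiv] at h₁ h₂
        omega

theorem IsCode.isBasePartition {σ : List (Option (Fin 3))} (h : IsCode 0 σ) (r : ℕ) :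
    IsBasePartition (flat (decode 0 σ r) : Multiset ℕ) :=
  ⟨(h.admissible_decode r).partsAtMostTwice, h.not_pairMove r, h.not_singletonMove r⟩

/-! ### The main theorem -/

theorem le_of_single_mem_finalSingles {a r x : ℕ} (hx : x ∈ tokenSingles (finalSingles a r)) :
    a / 2 + 1 ≤ x := by
  have := (admissible_finalSingles a r).fits _ (mem_tokenSingles.1 hx)
  simp only [Fits] at this
  omega

/-- The list `L` collects the pairs already passed, so that the induction can test singletons
against all pairs. -/
theorem countP_tokenSingles_decode {a : ℕ} (σ : List (Option (Fin 3))) (r : ℕ)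
    (L : List (ℕ × ℕ)) (hL : ∀ P ∈ L, P.2 ≤ a / 2 + 1) :
    (tokenSingles (decode a σ r)).countP
      (fun x => decide (∀ P ∈ L ++ tokenPairs (decode a σ r), P.2 ≤ x)) = r := by
  induction σ generalizing a L with
  | nil =>
    rw [decode, tokenPairs_finalSingles, List.append_nil]
    conv_rhs => rw [← length_tokenSingles_finalSingles a r]
    refine List.countP_eq_length.2 fun x hx => decide_eq_true fun P hP => ?_
    exact (hL P hP).trans (le_of_single_mem_finalSingles hx)
  | cons j σ ih =>
    cases j with
    | some j =>
      simp only [decode, tokenPairs, tokenSingles]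
      rw [List.append_cons]
      refine ih _ fun P hP => ?_
      rcases List.mem_append.1 hP with hP | hP
      · have := hL P hP
        omega
      · rw [List.mem_singleton.1 hP]
        simp only [pairOfSum]
        omega
    | none =>
      simp only [decode, tokenPairs, tokenSingles]
      rw [List.countP_cons_of_neg, List.append_cons]
      · refine ih _ fun P hP => ?_
        rcases List.mem_append.1 hP with hP | hP
        · have := hL P hP
          omega
        · rw [List.mem_singleton.1 hP]
          simp only [pairOfSum]
          omega
      · intro h
        have := of_decide_eq_true h (pairOfSum (a + 5)) (by simp)
        simp only [pairOfSum] at this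
        omega

theorem IsCode.n₁₂_decode {σ : List (Option (Fin 3))} (h : IsCode 0 σ) (r : ℕ) :
    n₁₂ (flat (decode 0 σ r)) = r := by
  have hT := h.admissible_decode r
  have hc := countP_tokenSingles_decode (a := 0) σ r [] (by simp)
  rw [n₁₂, hT.singletons_flat]
  conv_rhs => rw [← hc]
  refine List.countP_congr fun x _ => ?_
  classical
  simp only [decide_eq_true_eq]
  rw [AfterAllPairs, hT.pairs_flat, List.nil_append]

theorem IsCode.n₂_decode {σ : List (Option (Fin 3))} (h : IsCode 0 σ) (r : ℕ) :
    n₂ (flat (decode 0 σ r)) = σ.length := by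
  rw [n₂, (h.admissible_decode r).pairs_flat, length_tokenPairs_decode]

theorem n₁₁_add_n₁₂ (s : Multiset ℕ) : n₁₁ s + n₁₂ s = (singletons s).length := by
  rw [n₁₁, n₁₂, add_comm, List.length_eq_countP_add_countP]
  congr 1
  refine List.countP_congr fun x _ => ?_
  simp

/-- The base partition described by a code. -/
def baseOfCode (p : {p : Code // IsCode 0 p.1}) : {s : Multiset ℕ // IsBasePartition s} :=
  ⟨flat (decode 0 p.1.1 p.1.2), p.2.isBasePartition p.1.2⟩

theorem baseOfCode_bijective : Function.Bijective baseOfCode := by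
  constructor
  · rintro ⟨⟨σ, r⟩, h⟩ ⟨⟨σ', r'⟩, h'⟩ heq
    have heq : (flat (decode 0 σ r) : Multiset ℕ) = flat (decode 0 σ' r') :=
      congrArg Subtype.val heq
    have hr : r = r' := by rw [← h.n₁₂_decode r, heq, h'.n₁₂_decode r']
    have hσ : σ = σ' := tokenPairs_decode_injective (a := 0) (r := r) (r' := r') (by
      rw [← (h.admissible_decode r).pairs_flat, heq, (h'.admissible_decode r').pairs_flat])
    subst hr hσ
    rfl
  · rintro ⟨s, hs⟩
    obtain ⟨T, hT, rfl⟩ := hs.1.exists_admissible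
    obtain ⟨σ, r, hσ, rfl⟩ := exists_code_of_isBasePartition (T := []) hT hs
    exact ⟨⟨(σ, r), hσ⟩, rfl⟩

end PairMoves

end

theorem theorem1p3 :
    HasSum
      (fun β : {s : Multiset ℕ // PairMoves.IsBasePartition s} =>
        PairMoves.q ^ β.1.sum *
          PairMoves.t ^ (2 * PairMoves.n₂ β.1 + (PairMoves.n₁₁ β.1 + PairMoves.n₁₂ β.1)) *
          (PairMoves.invQPoch PairMoves.q (PairMoves.n₁₂ β.1) *
            PairMoves.invQPoch (PairMoves.q ^ 3) (PairMoves.n₂ β.1)))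
      PairMoves.H := by
  rw [← (Equiv.ofBijective _ PairMoves.baseOfCode_bijective).hasSum_iff,
    ← PairMoves.codeSeries_zero_eq_H]
  -- Words that are not codes have weight zero, so the sum over all words is the sum over codes.
  have h := (hasSum_subtype_iff_of_support_subset
    (s := {p : PairMoves.Code | PairMoves.IsCode 0 p.1}) fun p hp => ?_).2
    (PairMoves.hasSum_codeSeries 0)
  · refine PairMoves.hasSum_of_eq (fun p => ?_) h
    obtain ⟨⟨σ, r⟩, hσ⟩ := p
    have hσ : PairMoves.IsCode 0 σ := hσ
    have hT := hσ.admissible_decode r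
    simp only [Function.comp_apply, Equiv.ofBijective_apply, PairMoves.baseOfCode,
      PairMoves.codeTerm, hσ.weight_eq, PairMoves.n₁₁_add_n₁₂, hσ.n₁₂_decode, hσ.n₂_decode,
      hT.singletons_flat, PairMoves.length_flat, PairMoves.length_tokenPairs_decode,
      Multiset.sum_coe]
    ring
  · by_contra hσ
    exact hp (by rw [PairMoves.codeTerm, PairMoves.weight_eq_zero hσ, zero_mul])
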